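/- Let $\mathbb N=\{1,2,3,\dots\}$ and let $S\subseteq\mathbb N$ be multiplicative, i.e. $1\in S$ and the characteristic function of $S$ is multiplicative. For $n\in\mathbb N$ let $\sigma_S(n)$ be the sum of the divisors $d$ of $n$ with $\gcd(d,n/d)\in S$. Let $P$ be the set of primes $p$ such that $p^j\in S$ for every $j\ge 1$, and for a prime $p\notin P$ let $s(p)$ be the least $j\ge 1$ with $p^j\notin S$. Then the product $\prod_{p\notin P}\left(1-p^{-2s(p)}\right)$ over the primes $p$ not in $P$ converges, and $$\limsup_{n\to\infty}\frac{\sigma_S(n)}{n\log\log n}=e^{\gamma}\prod_{p\notin P}\left(1-\frac1{p^{2s(p)}}\right),$$ where $\gamma$ is Euler's constant. -/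

import Mathlib

open Filter

/-- The characteristic function `ρ_S` of a set `S` of positive integers, as an arithmetical
function. (Arithmetical functions take the value `0` at `0`, so whether `0 ∈ S` is irrelevant.) -/
noncomputable def rhoS (S : Set ℕ) : ArithmeticFunction ℝ :=
  open Classical in ⟨fun n => if n ≠ 0 ∧ n ∈ S then 1 else 0, by simp⟩

/-- `S` is multiplicative: `1 ∈ S` and its characteristic function is multiplicative. -/
def SetMultiplicative (S : Set ℕ) : Prop :=
  1 ∈ S ∧ (rhoS S).IsMultiplicative

/-- The set of `S`-divisors of `n`: the divisors `d` of `n` with `gcd (d, n / d) ∈ S`. -/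
noncomputable def divisorsS (S : Set ℕ) (n : ℕ) : Finset ℕ :=
  open Classical in {d ∈ n.divisors | Nat.gcd d (n / d) ∈ S}

/-- `σ_S(n)`, the sum of the `S`-divisors of `n`. -/
noncomputable def sigmaS (S : Set ℕ) (n : ℕ) : ℕ :=
  ∑ d ∈ divisorsS S n, d

/-- The set `P` of the primes all of whose powers with positive exponent lie in `S`. -/
def fullPrimes (S : Set ℕ) : Set ℕ :=
  {p | p.Prime ∧ ∀ j : ℕ, 1 ≤ j → p ^ j ∈ S}

/-- `s(p)`, the least `j ≥ 1` with `p ^ j ∉ S` (used for primes `p ∉ P` only). -/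
noncomputable def leastExp (S : Set ℕ) (p : ℕ) : ℕ :=
  sInf {j : ℕ | 1 ≤ j ∧ p ^ j ∉ S}

/-- For a prime outside `P` the least exponent exists and is `leastExp S p`. -/
theorem leastExp_isLeast (S : Set ℕ) {p : ℕ} (hp : p.Prime) (hP : p ∉ fullPrimes S) :
    IsLeast {j : ℕ | 1 ≤ j ∧ p ^ j ∉ S} (leastExp S p) := by
  have hne : {j : ℕ | 1 ≤ j ∧ p ^ j ∉ S}.Nonempty := by
    by_contra h
    rw [Set.not_nonempty_iff_eq_empty] at h
    refine hP ⟨hp, fun j hj => ?_⟩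
    by_contra hj'
    have : j ∈ {j : ℕ | 1 ≤ j ∧ p ^ j ∉ S} := ⟨hj, hj'⟩
    rw [h] at this
    exact this
  exact ⟨Nat.sInf_mem hne, fun _ hj => Nat.sInf_le hj⟩

/-! By multiplicativity, σ_S(n)/n is a product of local factors ∑_{i≤a} p^{-i} ρ_S(p^{min(a-i,i)}),
where p^a exactly divides n. For p ∉ P and s = s(p), the exponent a = 2s-1 gives the full geometric
sum (1-p^{-2s})/(1-1/p). No exponent does better: if a < 2s there are at most 2s terms, and if a ≥
2s the term p^{-s} is missing, which costs more than all terms beyond p^{-(2s-1)} can return. For p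
∈ P the supremum (1-1/p)^{-1} is approached as a → ∞ (`sigmaRatio_prime_pow_le`,
`sigmaRatio_prime_pow_eq`).

Multiplied over p ≤ y, these suprema form `localSupProd S y`, asymptotic to log y times the claimed
limit by Mertens' third theorem. For the upper bound take y = ⌊log n⌋: the prime factors of n above
y are too few to matter (`sigmaRatio_le`). For the lower bound take n = `extremal S K y`, with
exponents 2 min(s,K) - 1 (2K - 1 if p ∈ P): truncation loses only 1 - O(4^{-K}), and log log n ≤ log
y + O_K(1).

Mertens' theorems are proved as well. Partial summation gives ∑_{p≤N} 1/p - log log N → M. To find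
M, the primes are grouped into dyadic blocks and compared with the harmonic series: Abel's theorem
relates M - γ to the behaviour of ∑ p^{-1-δ} as δ → 0+, which is known from the pole of ζ. -/

/-! ### Mertens' first theorem, and the second without its constant -/

theorem sum_Ioc_zero_eq_sum_range_succ (f : ℕ → ℝ) (N : ℕ) :
    ∑ n ∈ Finset.Ioc 0 N, f n = ∑ n ∈ Finset.range N, f (n + 1) := by
  induction N with
  | zero => simp
  | succ N ih => rw [Finset.sum_Ioc_succ_top (Nat.zero_le N), Finset.sum_range_succ, ih]

-- Evaluate log N! both as ∑ Λ(n)⌊N/n⌋ and by elementary Stirling bounds. Dropping the floors costs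
-- at most ψ(N) = O(N), and everything is divided by N.
open Topology Finset in
theorem exists_bound_sum_vonMangoldt_div :
    ∃ C : ℝ, ∀ N : ℕ,
      |∑ n ∈ range (N + 1), ArithmeticFunction.vonMangoldt n / n - Real.log N| ≤ C := by
  refine ⟨Real.log 4 + 4 + 1, fun N => ?_⟩
  have h4 : (0 : ℝ) ≤ Real.log 4 := Real.log_nonneg (by norm_num)
  rcases Nat.eq_zero_or_pos N with rfl | hN
  · simp; linarith
  have hN' : (0 : ℝ) < N := by exact_mod_cast hN
  have hrange : ∑ n ∈ range (N + 1), ArithmeticFunction.vonMangoldt n / (n : ℝ) =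
      ∑ n ∈ Ioc 0 N, ArithmeticFunction.vonMangoldt n / (n : ℝ) := by
    rw [sum_range_succ', sum_Ioc_zero_eq_sum_range_succ]
    simp
  have hlog : Real.log (N.factorial) =
      ∑ n ∈ Ioc 0 N, ArithmeticFunction.vonMangoldt n * ((N / n : ℕ) : ℝ) := by
    rw [← ArithmeticFunction.sum_Ioc_mul_zeta_eq_sum, ArithmeticFunction.vonMangoldt_mul_zeta]
    rw [← prod_range_add_one_eq_factorial]
    push_cast
    rw [Real.log_prod (by intros; positivity), sum_Ioc_zero_eq_sum_range_succ]
    simp [ArithmeticFunction.log_apply]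
  have hψ : ∑ n ∈ Ioc 0 N, ArithmeticFunction.vonMangoldt n ≤ (Real.log 4 + 4) * N := by
    have := Chebyshev.psi_le_const_mul_self (x := N) hN'.le
    simpa [Chebyshev.psi] using this
  have hle : Real.log (N.factorial) ≤ N * ∑ n ∈ Ioc 0 N, ArithmeticFunction.vonMangoldt n / n := by
    rw [hlog, mul_sum]
    refine sum_le_sum fun n hn => ?_
    have : ((N / n : ℕ) : ℝ) ≤ N / n := Nat.cast_div_le
    calc _ ≤ ArithmeticFunction.vonMangoldt n * (N / n : ℝ) := by
          gcongr
      _ = _ := by ring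
  have hge : N * ∑ n ∈ Ioc 0 N, ArithmeticFunction.vonMangoldt n / n ≤
      Real.log (N.factorial) + (Real.log 4 + 4) * N := by
    refine le_trans ?_ (add_le_add_right hψ _)
    rw [hlog, mul_sum, ← sum_add_distrib]
    refine sum_le_sum fun n hn => ?_
    have hn0 : 0 < n := (mem_Ioc.1 hn).1
    have : (N : ℝ) / n ≤ ((N / n : ℕ) : ℝ) + 1 := by
      rw [← Nat.floor_div_eq_div (K := ℝ)]
      exact (Nat.lt_floor_add_one _).le
    calc _ = ArithmeticFunction.vonMangoldt n * (N / n : ℝ) := by ring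
      _ ≤ ArithmeticFunction.vonMangoldt n * (((N / n : ℕ) : ℝ) + 1) := by
          gcongr
      _ = _ := by ring
  have hst := Stirling.le_log_factorial_stirling hN.ne'
  have hlogN : 0 ≤ Real.log N := Real.log_natCast_nonneg N
  have hpi : 0 ≤ Real.log (2 * Real.pi) := Real.log_nonneg (by linarith [Real.pi_gt_three])
  have hup : Real.log (N.factorial) ≤ N * Real.log N := by
    rw [← Real.log_pow]
    exact Real.log_le_log (by positivity) (by exact_mod_cast Nat.factorial_le_pow N)
  rw [hrange]
  set X := ∑ n ∈ Ioc 0 N, ArithmeticFunction.vonMangoldt n / (n : ℝ)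
  rw [abs_le]
  constructor
  · have : (N : ℝ) * (Real.log N - 1) ≤ N * X := by linarith
    have := le_of_mul_le_mul_left this hN'
    linarith
  · have : (N : ℝ) * X ≤ N * (Real.log N + (Real.log 4 + 4)) := by linarith
    have := le_of_mul_le_mul_left this hN'
    linarith

open Topology Finset in
/-- Mertens' first theorem. -/
theorem exists_bound_sum_prime_log_div :
    ∃ C : ℝ, ∀ N : ℕ,
      |∑ n ∈ range (N + 1), (if n.Prime then Real.log n / n else 0) - Real.log N| ≤ C := by
  obtain ⟨C, hC⟩ := exists_bound_sum_vonMangoldt_div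
  -- Modulo 1 the residue class is all of ℕ, so this says that proper prime powers contribute a
  -- convergent series.
  have hs := ArithmeticFunction.vonMangoldt.summable_residueClass_non_primes_div (q := 1) 0
  set f : ℕ → ℝ := fun n => (if n.Prime then 0 else
    ArithmeticFunction.vonMangoldt.residueClass (0 : ZMod 1) n) / n with hf
  have hf0 : ∀ n, 0 ≤ f n := fun n => by
    have := ArithmeticFunction.vonMangoldt.residueClass_nonneg (0 : ZMod 1) n
    simp only [hf]; positivity
  refine ⟨C + ∑' n, f n, fun N => ?_⟩
  have key : ∑ n ∈ range (N + 1), (if n.Prime then Real.log n / n else 0) =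
      ∑ n ∈ range (N + 1), ArithmeticFunction.vonMangoldt n / n - ∑ n ∈ range (N + 1), f n := by
    rw [← sum_sub_distrib]
    refine sum_congr rfl fun n _ => ?_
    have h1 : n ∈ {n : ℕ | (n : ZMod 1) = 0} := Subsingleton.elim _ _
    by_cases hp : n.Prime
    · simp [hf, hp, ArithmeticFunction.vonMangoldt_apply_prime hp]
    · simp only [hf, hp, if_false, ArithmeticFunction.vonMangoldt.residueClass,
        Set.indicator_of_mem h1, sub_self]
  have h1 := hs.sum_le_tsum (range (N + 1)) fun n _ => hf0 n
  have h2 : 0 ≤ ∑ n ∈ range (N + 1), f n := sum_nonneg fun n _ => hf0 n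
  have h3 := abs_le.1 (hC N)
  rw [key, abs_le]
  constructor <;> linarith

-- With a = log x and b = log(x+1), log b - log a lies between 1 - a/b and b/a - 1, whose gap is
-- (b-a)²/(ab) = O(x^{-2}).
open Topology Finset in
theorem summable_log_increment_sub_loglog_increment :
    Summable fun i : ℕ => (Real.log (i + 2 : ℕ) - Real.log (i + 1 : ℕ)) / Real.log (i + 2 : ℕ) -
      (Real.log (Real.log (i + 2 : ℕ)) - Real.log (Real.log (i + 1 : ℕ))) := by
  -- Drops i = 0, where `Real.log (Real.log 1)` has the default value 0.
  rw [← summable_nat_add_iff 1]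
  have hs : Summable fun i : ℕ => 1 / (Real.log 2) ^ 2 * (1 / ((i + 2 : ℕ) : ℝ) ^ 2) :=
    ((summable_nat_add_iff 2).2 (Real.summable_one_div_nat_pow.2 one_lt_two)).mul_left _
  refine Summable.of_norm_bounded hs fun i => ?_
  have h2 : 0 < Real.log 2 := Real.log_pos one_lt_two
  have hx : (2 : ℝ) ≤ ((i + 2 : ℕ) : ℝ) := by push_cast; linarith [(Nat.cast_nonneg i : (0:ℝ) ≤ i)]
  set x : ℝ := ((i + 2 : ℕ) : ℝ) with hxdef
  have e1 : ((i + 1 + 2 : ℕ) : ℝ) = x + 1 := by rw [hxdef]; push_cast; ring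
  have e2 : ((i + 1 + 1 : ℕ) : ℝ) = x := rfl
  rw [e1]
  set a := Real.log x with ha
  set b := Real.log (x + 1) with hb
  have ha2 : Real.log 2 ≤ a := Real.log_le_log two_pos hx
  have hab : a ≤ b := Real.log_le_log (by linarith) (by linarith)
  have ha0 : 0 < a := h2.trans_le ha2
  have hb0 : 0 < b := ha0.trans_le hab
  have hd : b - a ≤ 1 / x := by
    rw [ha, hb, ← Real.log_div (by linarith) (by linarith)]
    refine (Real.log_le_sub_one_of_pos (by positivity)).trans_eq ?_
    field_simp; ring
  have hl : Real.log b - Real.log a = Real.log (b / a) := (Real.log_div hb0.ne' ha0.ne').symm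
  have hu : Real.log (b / a) ≤ b / a - 1 := Real.log_le_sub_one_of_pos (by positivity)
  have hlo : 1 - (b / a)⁻¹ ≤ Real.log (b / a) := Real.one_sub_inv_le_log_of_pos (by positivity)
  rw [inv_div] at hlo
  have h1 : (b - a) / b = 1 - a / b := by field_simp
  have h3 : b / a - 1 - (1 - a / b) ≤ 1 / (Real.log 2) ^ 2 * (1 / x ^ 2) := by
    have : b / a - 1 - (1 - a / b) = (b - a) ^ 2 / (a * b) := by field_simp
    rw [this, div_mul_div_comm, one_mul]
    calc (b - a) ^ 2 / (a * b) ≤ (1 / x) ^ 2 / (Real.log 2 * Real.log 2) := by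
          gcongr
          linarith
      _ = _ := by field_simp
  rw [hl, h1, Real.norm_eq_abs, abs_le]
  constructor
  · linarith
  · have : 0 ≤ 1 / (Real.log 2) ^ 2 * (1 / x ^ 2) := by positivity
    linarith

open Topology Finset in
/-- Mertens' second theorem, with an unspecified constant. -/
theorem exists_tendsto_sum_prime_inv_sub_loglog :
    ∃ M : ℝ, Tendsto (fun N : ℕ => ∑ n ∈ range (N + 1), (if n.Prime then 1 / (n : ℝ) else 0) -
      Real.log (Real.log N)) atTop (𝓝 M) := by
  obtain ⟨C, hC⟩ := exists_bound_sum_prime_log_div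
  -- Dirichlet's test: f decreases to 0, and the partial sums of z are bounded by the first theorem.
  -- The subtracted increments of log, weighted by f, telescope to log log up to a summable error.
  set f : ℕ → ℝ := fun i => 1 / Real.log (i + 2 : ℕ)
  set z : ℕ → ℝ := fun i => (if (i + 2).Prime then Real.log (i + 2 : ℕ) / (i + 2 : ℕ) else 0) -
    (Real.log (i + 2 : ℕ) - Real.log (i + 1 : ℕ)) with hz
  have hshift : ∀ g : ℕ → ℝ, ∀ n : ℕ, ∑ i ∈ range (n + 2), (if i.Prime then g i else 0) =
      ∑ i ∈ range n, (if (i + 2).Prime then g (i + 2) else 0) := by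
    intro g n
    rw [sum_range_succ', sum_range_succ']
    simp [Nat.not_prime_zero, Nat.not_prime_one]
  have hpos : ∀ i : ℕ, 0 < Real.log (i + 2 : ℕ) := fun i =>
    Real.log_pos (by exact_mod_cast (by omega : 1 < i + 2))
  have hanti : Antitone f := fun i j hij => by
    refine one_div_le_one_div_of_le (hpos i) (Real.log_le_log (by positivity) ?_)
    exact_mod_cast (by omega : i + 2 ≤ j + 2)
  have hf0 : Tendsto f atTop (𝓝 0) := by
    have h1 : Tendsto (fun i : ℕ => Real.log (i + 2 : ℕ)) atTop atTop :=
      Real.tendsto_log_atTop.comp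
        (tendsto_natCast_atTop_atTop.comp (tendsto_add_atTop_nat 2))
    exact h1.inv_tendsto_atTop.congr fun i => (one_div _).symm
  have hbd : ∀ n, ‖∑ i ∈ range n, z i‖ ≤ C := by
    intro n
    have : ∑ i ∈ range n, z i =
        ∑ i ∈ range (n + 1 + 1), (if i.Prime then Real.log i / i else 0) -
          Real.log ((n + 1 : ℕ) : ℝ) := by
      rw [hshift (fun i => Real.log i / i) n]
      simp only [hz]
      rw [sum_sub_distrib, sum_range_sub (fun i : ℕ => Real.log (i + 1 : ℕ))]
      simp
    rw [this]
    exact hC _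
  obtain ⟨L, hL⟩ := cauchySeq_tendsto_of_complete
    (hanti.cauchySeq_series_mul_of_tendsto_zero_of_bounded hf0 hbd)
  have hT := summable_log_increment_sub_loglog_increment.hasSum.tendsto_sum_nat
  refine ⟨L + _, (tendsto_add_atTop_iff_nat 1).1 ((hL.add hT).congr fun n => ?_)⟩
  rw [hshift (fun i => 1 / (i : ℝ)) n, ← sum_add_distrib]
  have htel := sum_range_sub (fun i : ℕ => Real.log (Real.log (i + 1 : ℕ))) n
  simp only [zero_add, Nat.cast_one, Real.log_one, Real.log_zero, sub_zero] at htel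
  rw [← htel, ← sum_sub_distrib]
  refine sum_congr rfl fun i _ => ?_
  have := (hpos i).ne'
  simp only [f, hz, smul_eq_mul]
  split_ifs <;> field_simp <;> ring

/-! ### The prime zeta function near 1 -/

/-- The logarithmic series `-log (1 - y)` without its linear term. -/
noncomputable def logTail (y : ℝ) : ℝ := -Real.log (1 - y) - y

theorem norm_logTail_le {y : ℝ} (h1 : y ≤ 1 / 2) : ‖logTail y‖ ≤ 2 * y ^ 2 := by
  have hy : 0 < 1 - y := by linarith
  have hu := Real.log_le_sub_one_of_pos hy
  have hl := Real.one_sub_inv_le_log_of_pos hy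
  have : (1 - y)⁻¹ - 1 - y ≤ 2 * y ^ 2 := by
    have : (1 - y)⁻¹ - 1 - y = y ^ 2 / (1 - y) := by field_simp; ring
    rw [this, div_le_iff₀ hy]
    nlinarith [sq_nonneg y]
  rw [Real.norm_eq_abs, abs_le, logTail]
  constructor <;> nlinarith [sq_nonneg y]

theorem Nat.Primes.two_le_cast (p : Nat.Primes) : (2 : ℝ) ≤ (p : ℕ) := by
  exact_mod_cast p.2.two_le

theorem Nat.Primes.rpow_neg_le_inv (p : Nat.Primes) {s : ℝ} (hs : 1 ≤ s) :
    ((p : ℕ) : ℝ) ^ (-s) ≤ ((p : ℕ) : ℝ)⁻¹ := by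
  rw [← Real.rpow_neg_one]
  exact Real.rpow_le_rpow_of_exponent_le (by linarith [p.two_le_cast]) (by linarith)

theorem Nat.Primes.inv_le_half (p : Nat.Primes) : ((p : ℕ) : ℝ)⁻¹ ≤ 1 / 2 := by
  rw [one_div]
  exact inv_anti₀ two_pos p.two_le_cast

theorem summable_primes_two_mul_inv_sq :
    Summable fun p : Nat.Primes => 2 * (((p : ℕ) : ℝ)⁻¹) ^ 2 := by
  have : Summable fun n : ℕ => ((n : ℝ)⁻¹) ^ 2 := by
    simp
  exact (this.subtype _).mul_left 2

theorem norm_logTail_prime_le (p : Nat.Primes) {s : ℝ} (hs : 1 ≤ s) :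
    ‖logTail (((p : ℕ) : ℝ) ^ (-s))‖ ≤ 2 * (((p : ℕ) : ℝ)⁻¹) ^ 2 := by
  have h1 := p.rpow_neg_le_inv hs
  refine (norm_logTail_le (h1.trans p.inv_le_half)).trans ?_
  gcongr

theorem summable_logTail_prime {s : ℝ} (hs : 1 ≤ s) :
    Summable fun p : Nat.Primes => logTail (((p : ℕ) : ℝ) ^ (-s)) :=
  Summable.of_norm_bounded summable_primes_two_mul_inv_sq fun p => norm_logTail_prime_le p hs

open Topology in
theorem tendsto_tsum_logTail_prime :
    Tendsto (fun s : ℝ => ∑' p : Nat.Primes, logTail (((p : ℕ) : ℝ) ^ (-s))) (𝓝[>] 1)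
      (𝓝 (∑' p : Nat.Primes, logTail (((p : ℕ) : ℝ)⁻¹))) := by
  refine tendsto_tsum_of_dominated_convergence summable_primes_two_mul_inv_sq (fun p => ?_) ?_
  · have h2 := p.two_le_cast
    have hh := p.inv_le_half
    have h1 : Tendsto (fun s : ℝ => ((p : ℕ) : ℝ) ^ (-s)) (𝓝[>] 1) (𝓝 (((p : ℕ) : ℝ)⁻¹)) := by
      rw [← Real.rpow_neg_one]
      refine Tendsto.mono_left ?_ nhdsWithin_le_nhds
      exact (continuous_const.rpow continuous_neg fun _ =>
        Or.inl (Nat.cast_ne_zero.2 p.2.ne_zero)).tendsto 1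
    have hc : ContinuousAt logTail (((p : ℕ) : ℝ)⁻¹) := by
      unfold logTail
      refine ContinuousAt.sub (ContinuousAt.neg (ContinuousAt.log ?_ ?_)) continuousAt_id
      · fun_prop
      · linarith
    exact hc.tendsto.comp h1
  · filter_upwards [self_mem_nhdsWithin] with s hs p
    exact norm_logTail_prime_le p (le_of_lt hs)

/-- The logarithm of the Euler product, with -log(1-y) split as y + `logTail y`. -/
theorem log_tsum_rpow_eq {s : ℝ} (hs : 1 < s) :
    Real.log (∑' n : ℕ, 1 / (n : ℝ) ^ s) =
      ∑' p : Nat.Primes, ((p : ℕ) : ℝ) ^ (-s) +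
        ∑' p : Nat.Primes, logTail (((p : ℕ) : ℝ) ^ (-s)) := by
  have hs1 : Summable fun p : Nat.Primes => ((p : ℕ) : ℝ) ^ (-s) :=
    Nat.Primes.summable_rpow.2 (by linarith)
  have hs2 := summable_logTail_prime hs.le
  let f : ℕ →*₀ ℝ :=
    { toFun := fun n => (n : ℝ) ^ (-s)
      map_zero' := by rw [Nat.cast_zero]; exact Real.zero_rpow (by linarith : -s < 0).ne
      map_one' := by simp
      map_mul' := fun m n => by
        push_cast; exact Real.mul_rpow (Nat.cast_nonneg m) (Nat.cast_nonneg n) }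
  have hf : ∀ n, f n = 1 / (n : ℝ) ^ s := fun n => by
    show (n : ℝ) ^ (-s) = _
    rw [Real.rpow_neg (Nat.cast_nonneg n), one_div]
  have hsum : Summable fun n => ‖f n‖ := by
    simp only [hf, norm_div, norm_one]
    refine (Real.summable_one_div_nat_rpow.2 hs).congr fun n => ?_
    rw [Real.norm_of_nonneg (by positivity)]
  have hprod := EulerProduct.eulerProduct_completely_multiplicative_hasProd hsum
  have hexp := (hs1.hasSum.add hs2.hasSum).rexp
  have heq : (Real.exp ∘ fun p : Nat.Primes => ((p : ℕ) : ℝ) ^ (-s) +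
      logTail (((p : ℕ) : ℝ) ^ (-s))) = fun p : Nat.Primes => (1 - f p)⁻¹ := by
    funext p
    have h1 : (f p : ℝ) ≤ 1 / 2 := (p.rpow_neg_le_inv hs.le).trans p.inv_le_half
    show Real.exp (f p + (-Real.log (1 - f p) - f p)) = _
    rw [show f p + (-Real.log (1 - f p) - f p) = -Real.log (1 - f p) by ring, Real.exp_neg,
      Real.exp_log (by linarith)]
  rw [heq] at hexp
  have := hprod.unique hexp
  simp only [hf] at this
  rw [this, Real.log_exp]

open Topology in
theorem tendsto_tsum_prime_rpow_add_log :
    Tendsto (fun s : ℝ => ∑' p : Nat.Primes, ((p : ℕ) : ℝ) ^ (-s) + Real.log (s - 1)) (𝓝[>] 1)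
      (𝓝 (-∑' p : Nat.Primes, logTail (((p : ℕ) : ℝ)⁻¹))) := by
  have h1 : Tendsto (fun s : ℝ => Real.log ((s - 1) * ∑' n : ℕ, 1 / (n : ℝ) ^ s)) (𝓝[>] 1)
      (𝓝 0) := by
    have := tendsto_sub_mul_tsum_nat_rpow.log one_ne_zero
    rwa [Real.log_one] at this
  have h2 := h1.sub tendsto_tsum_logTail_prime
  rw [zero_sub] at h2
  refine h2.congr' ?_
  filter_upwards [self_mem_nhdsWithin] with s (hs : 1 < s)
  have hZ : 0 < ∑' n : ℕ, 1 / (n : ℝ) ^ s :=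
    (Real.summable_one_div_nat_rpow.2 hs).tsum_pos (fun n => by positivity) 1 (by simp)
  rw [Real.log_mul (by linarith) hZ.ne', log_tsum_rpow_eq hs]
  ring

/-! ### The constant in Mertens' second theorem, and the third theorem -/

/-- The reciprocal of a prime, extended by zero. -/
noncomputable def primeInv (n : ℕ) : ℝ := if n.Prime then 1 / (n : ℝ) else 0

theorem primeInv_nonneg (n : ℕ) : 0 ≤ primeInv n := by
  unfold primeInv; split_ifs <;> positivity

theorem hasSum_primeInv_mul_rpow {δ : ℝ} (hδ : 0 < δ) :
    HasSum (fun n : ℕ => primeInv n * (n : ℝ) ^ (-δ))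
      (∑' p : Nat.Primes, ((p : ℕ) : ℝ) ^ (-(1 + δ))) := by
  have h := (Nat.Primes.summable_rpow.2 (by linarith : -(1 + δ) < -1)).hasSum
  have h' : HasSum ((fun n : ℕ => (n : ℝ) ^ (-(1 + δ))) ∘ ((↑) : {p : ℕ | p.Prime} → ℕ))
      (∑' p : Nat.Primes, ((p : ℕ) : ℝ) ^ (-(1 + δ))) := h
  rw [hasSum_subtype_iff_indicator] at h'
  convert h' using 1
  funext n
  by_cases hn : n.Prime
  · have : (0 : ℝ) < n := by exact_mod_cast hn.pos
    rw [Set.indicator_of_mem (show n ∈ {p : ℕ | p.Prime} from hn), primeInv, if_pos hn, neg_add,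
      Real.rpow_add this, Real.rpow_neg_one, one_div]
  · rw [Set.indicator_of_notMem (show n ∉ {p : ℕ | p.Prime} from hn), primeInv, if_neg hn, zero_mul]

/-- The sum of the reciprocals of the primes in the dyadic block `[2 ^ m, 2 ^ (m + 1))`. -/
noncomputable def dyadicPrimeInv (m : ℕ) : ℝ := ∑ n ∈ Finset.Ico (2 ^ m) (2 ^ (m + 1)), primeInv n

theorem sum_range_dyadic (c : ℕ → ℝ) (hc : c 0 = 0) (M : ℕ) :
    ∑ m ∈ Finset.range M, ∑ n ∈ Finset.Ico (2 ^ m) (2 ^ (m + 1)), c n =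
      ∑ n ∈ Finset.range (2 ^ M), c n := by
  induction M with
  | zero => simp [hc]
  | succ M ih =>
    rw [Finset.sum_range_succ, ih, Finset.range_eq_Ico,
      Finset.sum_Ico_consecutive _ (Nat.zero_le _) (Nat.pow_le_pow_right two_pos (Nat.le_succ M)),
      ← Finset.range_eq_Ico]

/-- Rounding n down to a power of two turns the prime zeta function into a power series in 2^{-δ},
open to Abel's theorem, at the cost of a factor 2^δ → 1. -/
theorem two_rpow_neg_pow_log_bounds {δ : ℝ} (hδ : 0 < δ) {n : ℕ} (hn : n ≠ 0) :
    (n : ℝ) ^ (-δ) ≤ ((2 : ℝ) ^ (-δ)) ^ Nat.log 2 n ∧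
      ((2 : ℝ) ^ (-δ)) ^ Nat.log 2 n ≤ (2 : ℝ) ^ δ * (n : ℝ) ^ (-δ) := by
  have hn0 : (0 : ℝ) < n := by positivity
  have e : ((2 : ℝ) ^ (-δ)) ^ Nat.log 2 n = ((2 : ℝ) ^ Nat.log 2 n) ^ (-δ) :=
    (Real.rpow_pow_comm two_pos.le _ _).symm ▸ rfl
  have h1 : (2 : ℝ) ^ Nat.log 2 n ≤ n := by exact_mod_cast Nat.pow_log_le_self 2 hn
  have h2 : (n : ℝ) ≤ 2 ^ Nat.log 2 n * 2 := by
    rw [← pow_succ]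
    exact_mod_cast (Nat.lt_pow_succ_log_self one_lt_two n).le
  rw [e]
  constructor
  · exact Real.rpow_le_rpow_of_nonpos (by positivity) h1 (by linarith)
  · calc ((2 : ℝ) ^ Nat.log 2 n) ^ (-δ)
        = 2 ^ δ * ((2 : ℝ) ^ Nat.log 2 n * 2) ^ (-δ) := by
          rw [Real.mul_rpow (by positivity) two_pos.le, mul_left_comm, ← Real.rpow_add two_pos]
          simp
      _ ≤ _ := by
          gcongr 2 ^ δ * ?_
          exact Real.rpow_le_rpow_of_nonpos hn0 h2 (by linarith)

/-- Replacing `n ^ (-δ)` by its value at the largest power of two below `n`. -/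
theorem dyadic_tsum_bounds {δ : ℝ} (hδ : 0 < δ) :
    Summable (fun m => dyadicPrimeInv m * ((2 : ℝ) ^ (-δ)) ^ m) ∧
    ∑' p : Nat.Primes, ((p : ℕ) : ℝ) ^ (-(1 + δ)) ≤
      ∑' m, dyadicPrimeInv m * ((2 : ℝ) ^ (-δ)) ^ m ∧
    ∑' m, dyadicPrimeInv m * ((2 : ℝ) ^ (-δ)) ^ m ≤
      2 ^ δ * ∑' p : Nat.Primes, ((p : ℕ) : ℝ) ^ (-(1 + δ)) := by
  have hP := hasSum_primeInv_mul_rpow hδ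
  set x : ℝ := (2 : ℝ) ^ (-δ) with hx
  have hx0 : 0 < x := by positivity
  set c : ℕ → ℝ := fun n => primeInv n * x ^ Nat.log 2 n with hc
  have hc0 : ∀ n, 0 ≤ c n := fun n => mul_nonneg (primeInv_nonneg n) (by positivity)
  have hlow : ∀ n, primeInv n * (n : ℝ) ^ (-δ) ≤ c n := fun n => by
    rcases eq_or_ne n 0 with rfl | hn
    · simp [hc, primeInv, Nat.not_prime_zero]
    · exact mul_le_mul_of_nonneg_left (two_rpow_neg_pow_log_bounds hδ hn).1 (primeInv_nonneg n)
  have hup : ∀ n, c n ≤ 2 ^ δ * (primeInv n * (n : ℝ) ^ (-δ)) := fun n => by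
    rcases eq_or_ne n 0 with rfl | hn
    · simp [hc, primeInv, Nat.not_prime_zero]
    · rw [mul_left_comm]
      exact mul_le_mul_of_nonneg_left (two_rpow_neg_pow_log_bounds hδ hn).2 (primeInv_nonneg n)
  have hcs : Summable c := Summable.of_nonneg_of_le hc0 hup (hP.summable.mul_left _)
  have hblock : ∀ m, dyadicPrimeInv m * x ^ m =
      ∑ n ∈ Finset.Ico (2 ^ m) (2 ^ (m + 1)), c n := fun m => by
    rw [dyadicPrimeInv, Finset.sum_mul]
    refine Finset.sum_congr rfl fun n hn => ?_
    rw [Finset.mem_Ico] at hn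
    have : Nat.log 2 n = m := Nat.log_eq_of_pow_le_of_lt_pow hn.1 hn.2
    simp only [hc, this]
  have hsum : HasSum (fun m => dyadicPrimeInv m * x ^ m) (∑' n, c n) := by
    rw [hasSum_iff_tendsto_nat_of_nonneg fun m => ?_]
    · refine (hcs.hasSum.tendsto_sum_nat.comp
        (tendsto_pow_atTop_atTop_of_one_lt one_lt_two)).congr fun M => ?_
      simp only [hblock]
      rw [sum_range_dyadic c (by simp [hc, primeInv, Nat.not_prime_zero])]
      rfl
    · rw [hblock]
      exact Finset.sum_nonneg fun n _ => hc0 n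
  refine ⟨hsum.summable, ?_, ?_⟩
  · rw [hsum.tsum_eq, ← hP.tsum_eq]
    exact hP.summable.tsum_le_tsum hlow hcs
  · rw [hsum.tsum_eq, ← hP.tsum_eq, ← tsum_mul_left]
    exact hcs.tsum_le_tsum hup (hP.summable.mul_left _)

open Topology in
theorem tendsto_two_rpow_sub_one_div :
    Tendsto (fun δ : ℝ => ((2 : ℝ) ^ δ - 1) / δ) (𝓝[>] 0) (𝓝 (Real.log 2)) := by
  have h : HasDerivAt (fun δ : ℝ => (2 : ℝ) ^ δ) (Real.log 2) 0 := by
    simpa using (hasDerivAt_id (0 : ℝ)).const_rpow (a := 2) two_pos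
  have := h.tendsto_slope_zero_right
  simpa [div_eq_inv_mul] using this

open Topology in
theorem tendsto_one_sub_two_rpow_neg_div :
    Tendsto (fun δ : ℝ => (1 - (2 : ℝ) ^ (-δ)) / δ) (𝓝[>] 0) (𝓝 (Real.log 2)) := by
  have h : HasDerivAt (fun δ : ℝ => -(2 : ℝ) ^ (-δ)) (Real.log 2) 0 := by
    simpa using ((hasDerivAt_neg (0 : ℝ)).const_rpow (a := 2) two_pos).fun_neg
  have := h.tendsto_slope_zero_right
  simpa [div_eq_inv_mul, add_comm, sub_eq_add_neg] using this

open Topology in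
/-- The prime zeta function near its singularity. -/
theorem tendsto_primeZeta_add_log :
    Tendsto (fun δ : ℝ => ∑' p : Nat.Primes, ((p : ℕ) : ℝ) ^ (-(1 + δ)) + Real.log δ) (𝓝[>] 0)
      (𝓝 (-∑' p : Nat.Primes, logTail (((p : ℕ) : ℝ)⁻¹))) := by
  have h : Tendsto (fun δ : ℝ => 1 + δ) (𝓝[>] 0) (𝓝[>] 1) := by
    refine tendsto_nhdsWithin_iff.2 ⟨?_, ?_⟩
    · have : Tendsto (fun δ : ℝ => 1 + δ) (𝓝 0) (𝓝 (1 + 0)) :=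
        tendsto_const_nhds.add tendsto_id
      rw [add_zero] at this
      exact this.mono_left nhdsWithin_le_nhds
    · filter_upwards [self_mem_nhdsWithin] with δ (hδ : 0 < δ)
      show 1 < 1 + δ
      linarith
  refine (tendsto_tsum_prime_rpow_add_log.comp h).congr fun δ => ?_
  simp

-- The dyadic series exceeds the prime zeta function by at most (2^δ - 1) ∑ p^{-1-δ} = O(δ
-- log(1/δ)), and 1 - 2^{-δ} ~ δ log 2 accounts for log log 2.
open Topology in
theorem tendsto_dyadic_tsum_add_log :
    Tendsto (fun δ : ℝ => ∑' m, dyadicPrimeInv m * ((2 : ℝ) ^ (-δ)) ^ m +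
        Real.log (1 - (2 : ℝ) ^ (-δ))) (𝓝[>] 0)
      (𝓝 (-∑' p : Nat.Primes, logTail (((p : ℕ) : ℝ)⁻¹) + Real.log (Real.log 2))) := by
  have hlog2 : Real.log 2 ≠ 0 := (Real.log_pos one_lt_two).ne'
  have hP := tendsto_primeZeta_add_log
  have hid : Tendsto (fun δ : ℝ => δ) (𝓝[>] 0) (𝓝 0) := tendsto_id.mono_left nhdsWithin_le_nhds
  have hlog : Tendsto (fun δ : ℝ => δ * Real.log δ) (𝓝[>] 0) (𝓝 0) := by
    have := Real.continuous_mul_log.tendsto 0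
    rw [Real.log_zero, mul_zero] at this
    exact this.mono_left nhdsWithin_le_nhds
  have herr : Tendsto (fun δ : ℝ => ((2 : ℝ) ^ δ - 1) *
      ∑' p : Nat.Primes, ((p : ℕ) : ℝ) ^ (-(1 + δ))) (𝓝[>] 0) (𝓝 0) := by
    have := tendsto_two_rpow_sub_one_div.mul ((hid.mul hP).sub hlog)
    rw [zero_mul, sub_zero, mul_zero] at this
    refine this.congr' ?_
    filter_upwards [self_mem_nhdsWithin] with δ (hδ : 0 < δ)
    field_simp
    ring
  have hdiff : Tendsto (fun δ : ℝ => ∑' m, dyadicPrimeInv m * ((2 : ℝ) ^ (-δ)) ^ m -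
      ∑' p : Nat.Primes, ((p : ℕ) : ℝ) ^ (-(1 + δ))) (𝓝[>] 0) (𝓝 0) := by
    refine squeeze_zero' ?_ ?_ herr
    · filter_upwards [self_mem_nhdsWithin] with δ (hδ : 0 < δ)
      linarith [(dyadic_tsum_bounds hδ).2.1]
    · filter_upwards [self_mem_nhdsWithin] with δ (hδ : 0 < δ)
      linarith [(dyadic_tsum_bounds hδ).2.2]
  have h := (hdiff.add hP).add (tendsto_one_sub_two_rpow_neg_div.log hlog2)
  rw [zero_add] at h
  refine h.congr' ?_
  filter_upwards [self_mem_nhdsWithin] with δ (hδ : 0 < δ)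
  have hx : (2 : ℝ) ^ (-δ) < 1 := Real.rpow_lt_one_of_one_lt_of_neg one_lt_two (by linarith)
  rw [Real.log_div (by linarith) hδ.ne']
  ring

open Topology Finset in
/-- Mertens' second theorem with its constant. -/
theorem tendsto_sum_primeInv_sub_loglog :
    Tendsto (fun N : ℕ => ∑ n ∈ range (N + 1), primeInv n - Real.log (Real.log N)) atTop
      (𝓝 (Real.eulerMascheroniConstant - ∑' p : Nat.Primes, logTail (((p : ℕ) : ℝ)⁻¹))) := by
  obtain ⟨M, hM⟩ := exists_tendsto_sum_prime_inv_sub_loglog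
  change Tendsto (fun N : ℕ => ∑ n ∈ range (N + 1), primeInv n - Real.log (Real.log N)) atTop
    (𝓝 M) at hM
  have hlog2 : 0 < Real.log 2 := Real.log_pos one_lt_two
  -- The coefficients 1/m are those of -log(1-x), with 1/0 = 0. Their partial sums are harmonic
  -- numbers, which is where γ enters.
  set f : ℕ → ℝ := fun m => dyadicPrimeInv m - 1 / m with hf
  have hpart : Tendsto (fun K => ∑ m ∈ range K, f m) atTop
      (𝓝 (M + Real.log (Real.log 2) - Real.eulerMascheroniConstant)) := by
    have h1 := hM.comp (tendsto_pow_atTop_atTop_of_one_lt (r := 2) one_lt_two)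
    have h2 := Real.tendsto_harmonic_sub_log
    have h3 : Tendsto (fun K : ℕ => 1 / (K : ℝ)) atTop (𝓝 0) :=
      tendsto_one_div_atTop_nhds_zero_nat
    have h4 := ((h1.add_const (Real.log (Real.log 2))).sub h2).add h3
    rw [add_zero] at h4
    refine h4.congr' ?_
    filter_upwards [eventually_ge_atTop 2] with K hK
    -- The sum up to 2^K includes its endpoint and the dyadic blocks do not; for K ≥ 2 the endpoint
    -- is not prime.
    have hnp : primeInv (2 ^ K) = 0 := if_neg (Nat.Prime.not_prime_pow hK)
    have hK0 : (0 : ℝ) < K := by positivity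
    have hh : (harmonic K : ℝ) = ∑ m ∈ range K, 1 / (m : ℝ) + 1 / K := by
      rw [← sum_range_succ (fun m : ℕ => 1 / (m : ℝ)), sum_range_succ', harmonic]
      simp
    have hl : Real.log (Real.log ((2 ^ K : ℕ) : ℝ)) = Real.log K + Real.log (Real.log 2) := by
      rw [Nat.cast_pow, Real.log_pow, Real.log_mul hK0.ne' (by simpa using hlog2.ne')]
      simp
    simp only [hf, Function.comp_apply]
    rw [sum_range_succ, hnp, sum_sub_distrib, hh, hl]
    simp only [dyadicPrimeInv]
    rw [sum_range_dyadic primeInv (if_neg Nat.not_prime_zero)]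
    ring
  -- Abel's theorem gives the limit as x → 1-; equating it with `tendsto_dyadic_tsum_add_log`
  -- determines M.
  have habel := Real.tendsto_tsum_powerSeries_nhdsWithin_lt hpart
  have hx : Tendsto (fun δ : ℝ => (2 : ℝ) ^ (-δ)) (𝓝[>] 0) (𝓝[<] 1) := by
    refine tendsto_nhdsWithin_iff.2 ⟨?_, ?_⟩
    · have : Continuous fun δ : ℝ => (2 : ℝ) ^ (-δ) :=
        continuous_const.rpow continuous_neg fun _ => Or.inl two_ne_zero
      have := this.tendsto 0
      rw [neg_zero, Real.rpow_zero] at this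
      exact this.mono_left nhdsWithin_le_nhds
    · filter_upwards [self_mem_nhdsWithin] with δ (hδ : 0 < δ)
      exact Real.rpow_lt_one_of_one_lt_of_neg one_lt_two (by linarith)
  have hlim := (habel.comp hx).congr' (f₂ := fun δ : ℝ =>
      ∑' m, dyadicPrimeInv m * ((2 : ℝ) ^ (-δ)) ^ m + Real.log (1 - (2 : ℝ) ^ (-δ))) (by
    filter_upwards [self_mem_nhdsWithin] with δ (hδ : 0 < δ)
    have hlt : (2 : ℝ) ^ (-δ) < 1 := Real.rpow_lt_one_of_one_lt_of_neg one_lt_two (by linarith)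
    have hlt' : |(2 : ℝ) ^ (-δ)| < 1 := by rwa [abs_of_pos (by positivity)]
    have hs := Real.hasSum_pow_div_log_of_abs_lt_one hlt'
    set x := (2 : ℝ) ^ (-δ)
    have hs' : HasSum (fun m : ℕ => 1 / (m : ℝ) * x ^ m) (-Real.log (1 - x)) := by
      rw [← hasSum_nat_add_iff' 1]
      simpa [div_eq_inv_mul] using hs
    simp only [Function.comp_apply, hf, sub_mul]
    rw [(dyadic_tsum_bounds hδ).1.tsum_sub hs'.summable, hs'.tsum_eq, sub_neg_eq_add])
  have := tendsto_nhds_unique hlim tendsto_dyadic_tsum_add_log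
  have hMeq : M = Real.eulerMascheroniConstant -
      ∑' p : Nat.Primes, logTail (((p : ℕ) : ℝ)⁻¹) := by linarith
  rwa [← hMeq]

open Topology Finset in
/-- Mertens' third theorem. -/
theorem tendsto_prod_prime_one_sub_inv_div_log :
    Tendsto (fun N : ℕ => (∏ p ∈ range (N + 1) with p.Prime, (1 - (p : ℝ)⁻¹)⁻¹) / Real.log N) atTop
      (𝓝 (Real.exp Real.eulerMascheroniConstant)) := by
  have hs : Summable fun p : Nat.Primes => logTail (((p : ℕ) : ℝ)⁻¹) := by
    simpa [Real.rpow_neg_one] using summable_logTail_prime le_rfl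
  have h1 : HasSum ((fun n : ℕ => logTail ((n : ℝ)⁻¹)) ∘ ((↑) : {p : ℕ | p.Prime} → ℕ))
      (∑' p : Nat.Primes, logTail (((p : ℕ) : ℝ)⁻¹)) := hs.hasSum
  rw [hasSum_subtype_iff_indicator] at h1
  have h2 := h1.tendsto_sum_nat.comp (tendsto_add_atTop_nat 1)
  -- Since 1/p + `logTail (1/p)` = -log(1-1/p), the tail sums cancel and only γ remains.
  have h3 := (tendsto_sum_primeInv_sub_loglog.add h2).rexp
  rw [sub_add_cancel] at h3
  refine h3.congr' ?_
  filter_upwards [eventually_ge_atTop 2] with N hN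
  have hlN : 0 < Real.log N := Real.log_pos (by exact_mod_cast hN)
  simp only [Function.comp_apply]
  rw [sub_add_eq_add_sub, Real.exp_sub, Real.exp_log hlN, ← sum_add_distrib, Real.exp_sum,
    prod_filter]
  congr 1
  refine prod_congr rfl fun p _ => ?_
  by_cases hp : p.Prime
  · have hlt : (p : ℝ)⁻¹ ≤ 1 / 2 := Nat.Primes.inv_le_half ⟨p, hp⟩
    rw [Set.indicator_of_mem (show p ∈ {p : ℕ | p.Prime} from hp), primeInv, if_pos hp, if_pos hp,
      logTail, one_div, add_sub_cancel, Real.exp_neg, Real.exp_log (by linarith)]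
  · rw [Set.indicator_of_notMem (show p ∉ {p : ℕ | p.Prime} from hp), primeInv, if_neg hp,
      if_neg hp, add_zero, Real.exp_zero]

/-! ### Multiplicativity of σ_S and its local factors -/

theorem rhoS_apply (S : Set ℕ) {n : ℕ} (hn : n ≠ 0) [Decidable (n ∈ S)] :
    rhoS S n = if n ∈ S then 1 else 0 := by
  simp [rhoS, hn]

theorem sigmaS_eq_sum_rhoS (S : Set ℕ) (n : ℕ) :
    (sigmaS S n : ℝ) = ∑ d ∈ n.divisors, (d : ℝ) * rhoS S (Nat.gcd d (n / d)) := by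
  classical
  rw [sigmaS, divisorsS, Finset.sum_filter]
  push_cast
  refine Finset.sum_congr rfl fun d hd => ?_
  have hd0 : d ≠ 0 := (Nat.pos_of_mem_divisors hd).ne'
  rw [rhoS_apply S (Nat.gcd_ne_zero_left hd0)]
  split_ifs <;> simp

-- Divisors of mn factor as d₁d₂, and by coprimality the gcd with the cofactor splits into coprime
-- gcds for m and n, on which ρ_S is multiplicative.
open Finset in
theorem sigmaS_mul_of_coprime {S : Set ℕ} (hS : SetMultiplicative S) {m n : ℕ}
    (h : m.Coprime n) : (sigmaS S (m * n) : ℝ) = sigmaS S m * sigmaS S n := by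
  rw [sigmaS_eq_sum_rhoS, sigmaS_eq_sum_rhoS, sigmaS_eq_sum_rhoS, Nat.divisors_mul, mul_def,
    sum_image (by simpa using h.mul_injOn_divisors), sum_mul_sum, ← sum_product']
  refine sum_congr rfl fun x hx => ?_
  obtain ⟨h1, h2⟩ := mem_product.1 hx
  obtain ⟨a, ha⟩ := Nat.dvd_of_mem_divisors h1
  obtain ⟨b, hb⟩ := Nat.dvd_of_mem_divisors h2
  have hx1 := Nat.pos_of_mem_divisors h1
  have hx2 := Nat.pos_of_mem_divisors h2
  have e1 : m / x.1 = a := by rw [ha, Nat.mul_div_cancel_left _ hx1]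
  have e2 : n / x.2 = b := by rw [hb, Nat.mul_div_cancel_left _ hx2]
  have e3 : m * n / (x.1 * x.2) = a * b := by
    rw [ha, hb, mul_mul_mul_comm, Nat.mul_div_cancel_left _ (Nat.mul_pos hx1 hx2)]
  rw [ha, hb] at h
  have c12 : x.1.Coprime x.2 := h.coprime_mul_right.coprime_mul_right_right
  have c1b : x.1.Coprime b := h.coprime_mul_right.coprime_mul_left_right
  have ca2 : a.Coprime x.2 := h.coprime_mul_left.coprime_mul_right_right
  have cab : a.Coprime b := h.coprime_mul_left.coprime_mul_left_right
  have hg : Nat.gcd (x.1 * x.2) (a * b) = Nat.gcd x.1 a * Nat.gcd x.2 b := by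
    rw [cab.gcd_mul, Nat.Coprime.gcd_mul_right_cancel _ ca2.symm,
      Nat.Coprime.gcd_mul_left_cancel _ c1b]
  have hc : (Nat.gcd x.1 a).Coprime (Nat.gcd x.2 b) :=
    (c12.coprime_dvd_left (Nat.gcd_dvd_left _ _)).coprime_dvd_right (Nat.gcd_dvd_left _ _)
  rw [e1, e2, e3, hg, hS.2.2 hc]
  push_cast
  ring

theorem sigmaS_one {S : Set ℕ} (hS : SetMultiplicative S) : sigmaS S 1 = 1 := by
  have : (sigmaS S 1 : ℝ) = 1 := by
    rw [sigmaS_eq_sum_rhoS]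
    simp [hS.2.1]
  exact_mod_cast this

/-- The normalized divisor sum `σ_S(n) / n`. -/
noncomputable def sigmaRatio (S : Set ℕ) (n : ℕ) : ℝ := sigmaS S n / n

theorem sigmaRatio_nonneg (S : Set ℕ) (n : ℕ) : 0 ≤ sigmaRatio S n := by
  unfold sigmaRatio; positivity

theorem sigmaRatio_mul_of_coprime {S : Set ℕ} (hS : SetMultiplicative S) {m n : ℕ}
    (h : m.Coprime n) : sigmaRatio S (m * n) = sigmaRatio S m * sigmaRatio S n := by
  rw [sigmaRatio, sigmaS_mul_of_coprime hS h, sigmaRatio, sigmaRatio]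
  push_cast
  rw [div_mul_div_comm]

theorem sigmaRatio_one {S : Set ℕ} (hS : SetMultiplicative S) : sigmaRatio S 1 = 1 := by
  simp [sigmaRatio, sigmaS_one hS]

theorem sigmaRatio_eq_prod {S : Set ℕ} (hS : SetMultiplicative S) {n : ℕ} (hn : n ≠ 0) :
    sigmaRatio S n = ∏ p ∈ n.primeFactors, sigmaRatio S (p ^ n.factorization p) :=
  Nat.multiplicative_factorization (sigmaRatio S)
    (fun _ _ h => sigmaRatio_mul_of_coprime hS h) (sigmaRatio_one hS) hn

-- The index i is the exponent of the complementary divisor: d = p^{a-i}, so d/p^a = p^{-i}.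
open Finset in
theorem sigmaRatio_prime_pow (S : Set ℕ) {p : ℕ} (hp : p.Prime) (a : ℕ) :
    sigmaRatio S (p ^ a) =
      ∑ i ∈ range (a + 1), (p : ℝ)⁻¹ ^ i * rhoS S (p ^ min (a - i) i) := by
  have hp0 : (p : ℝ) ≠ 0 := by exact_mod_cast hp.ne_zero
  rw [sigmaRatio, sigmaS_eq_sum_rhoS, Nat.sum_divisors_prime_pow hp, ← sum_range_reflect, sum_div]
  refine sum_congr rfl fun i hi => ?_
  have hi' : i ≤ a := Nat.lt_succ_iff.1 (mem_range.1 hi)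
  have e : a + 1 - 1 - i = a - i := by omega
  have hdiv : p ^ a / p ^ (a - i) = p ^ i := by
    rw [Nat.pow_div (Nat.sub_le _ _) hp.pos, Nat.sub_sub_self hi']
  have hgcd : Nat.gcd (p ^ (a - i)) (p ^ i) = p ^ min (a - i) i := by
    rcases le_total (a - i) i with h | h
    · rw [min_eq_left h, Nat.gcd_eq_left (pow_dvd_pow p h)]
    · rw [min_eq_right h, Nat.gcd_eq_right (pow_dvd_pow p h)]
  have hpow : (p : ℝ) ^ a = p ^ (a - i) * p ^ i := by rw [← pow_add, Nat.sub_add_cancel hi']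
  rw [e, hdiv, hgcd]
  push_cast
  rw [hpow, inv_pow]
  field_simp

/-! ### Suprema of the local factors -/

/-- The factor of the limit product at `n`: it differs from `1` only at primes outside `P`. -/
noncomputable def limitFactor (S : Set ℕ) : ℕ → ℝ :=
  {p : ℕ | p.Prime ∧ p ∉ fullPrimes S}.mulIndicator fun p => 1 - 1 / (p : ℝ) ^ (2 * leastExp S p)

theorem limitFactor_apply (S : Set ℕ) {p : ℕ} (hp : p.Prime) (hP : p ∉ fullPrimes S) :
    limitFactor S p = 1 - 1 / (p : ℝ) ^ (2 * leastExp S p) :=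
  Set.mulIndicator_of_mem (show p ∈ {p : ℕ | p.Prime ∧ p ∉ fullPrimes S} from ⟨hp, hP⟩) _

theorem limitFactor_eq_one (S : Set ℕ) {p : ℕ} (h : ¬(p.Prime ∧ p ∉ fullPrimes S)) :
    limitFactor S p = 1 :=
  Set.mulIndicator_of_notMem (show p ∉ {p : ℕ | p.Prime ∧ p ∉ fullPrimes S} from h) _

theorem rhoS_le_one (S : Set ℕ) (n : ℕ) : rhoS S n ≤ 1 := by
  classical
  simp only [rhoS, ArithmeticFunction.coe_mk]
  split_ifs <;> norm_num

/-- Follows from p^{-2s} ≤ p^{-1}. It permits enlarging a product over the primes dividing n to one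
over all primes up to y. -/
theorem one_sub_inv_mul_limitFactor_ge_one (S : Set ℕ) {p : ℕ} (hp : p.Prime) :
    1 ≤ (1 - (p : ℝ)⁻¹)⁻¹ * limitFactor S p := by
  have hq := Nat.Primes.inv_le_half ⟨p, hp⟩
  have hq0 : (0 : ℝ) < (p : ℝ)⁻¹ := inv_pos.2 (by exact_mod_cast hp.pos)
  set q := (p : ℝ)⁻¹ with hqdef
  change q ≤ 1 / 2 at hq
  rw [← div_eq_inv_mul, le_div_iff₀ (by linarith), one_mul]
  by_cases hP : p ∈ fullPrimes S
  · rw [limitFactor_eq_one S (by simp [hP])]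
    linarith
  · rw [limitFactor_apply S hp hP, one_div, ← inv_pow, ← hqdef]
    have := (leastExp_isLeast S hp hP).1.1
    have : q ^ (2 * leastExp S p) ≤ q ^ 1 :=
      pow_le_pow_of_le_one hq0.le (by linarith) (by omega)
    linarith

open Finset in
theorem sigmaRatio_prime_pow_le (S : Set ℕ) {p : ℕ} (hp : p.Prime) (a : ℕ) :
    sigmaRatio S (p ^ a) ≤ (1 - (p : ℝ)⁻¹)⁻¹ * limitFactor S p := by
  have hq := Nat.Primes.inv_le_half ⟨p, hp⟩
  have hq0 : (0 : ℝ) < (p : ℝ)⁻¹ := inv_pos.2 (by exact_mod_cast hp.pos)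
  rw [sigmaRatio_prime_pow S hp]
  set q := (p : ℝ)⁻¹ with hqdef
  change q ≤ 1 / 2 at hq
  have hgeom : ∀ k : ℕ, ∑ i ∈ range k, q ^ i = (1 - q)⁻¹ * (1 - q ^ k) := fun k => by
    rw [geom_sum_eq (by linarith), ← neg_sub 1 q, ← neg_sub 1 (q ^ k), neg_div_neg_eq,
      div_eq_inv_mul]
  have hinv : 0 < (1 - q)⁻¹ := inv_pos.2 (by linarith)
  have hterm : ∀ i, q ^ i * rhoS S (p ^ min (a - i) i) ≤ q ^ i := fun i =>
    mul_le_of_le_one_right (by positivity) (rhoS_le_one S _)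
  have hle : ∑ i ∈ range (a + 1), q ^ i * rhoS S (p ^ min (a - i) i) ≤
      (1 - q)⁻¹ * (1 - q ^ (a + 1)) :=
    (sum_le_sum fun i _ => hterm i).trans_eq (hgeom _)
  by_cases hP : p ∈ fullPrimes S
  · rw [limitFactor_eq_one S (by simp [hP])]
    refine hle.trans (mul_le_mul_of_nonneg_left ?_ hinv.le)
    linarith [pow_pos hq0 (a + 1)]
  · rw [limitFactor_apply S hp hP, one_div, ← inv_pow, ← hqdef]
    obtain ⟨⟨hs1, hsS⟩, -⟩ := leastExp_isLeast S hp hP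
    set s := leastExp S p
    rcases lt_or_ge a (2 * s) with has | has
    · refine hle.trans (mul_le_mul_of_nonneg_left ?_ hinv.le)
      have : q ^ (2 * s) ≤ q ^ (a + 1) := pow_le_pow_of_le_one hq0.le (by linarith) has
      linarith
    · have hmem : s ∈ range (a + 1) := mem_range.2 (by omega)
      -- For a ≥ 2s the minimum is s, so the term i = s vanishes.
      have hz : rhoS S (p ^ min (a - s) s) = 0 := by
        classical
        rw [min_eq_right (by omega), rhoS_apply S (pow_ne_zero _ hp.ne_zero), if_neg hsS]
      have h1 : ∑ i ∈ range (a + 1), q ^ i * rhoS S (p ^ min (a - i) i) ≤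
          (1 - q)⁻¹ * (1 - q ^ (a + 1)) - q ^ s := by
        rw [← hgeom, ← add_sum_erase _ _ hmem, ← add_sum_erase _ (fun i => q ^ i) hmem, hz,
          mul_zero, zero_add, add_sub_cancel_left]
        exact sum_le_sum fun i _ => hterm i
      refine h1.trans ?_
      have h2 : q ^ s ≤ q := pow_le_of_le_one hq0.le (by linarith) (by omega)
      have h3 : q ^ (2 * s) = q ^ s * q ^ s := by rw [two_mul, pow_add]
      -- As q ≤ 1/2, q^s ≤ q ≤ 1 - q: the missing term q^s is at least the geometric tail
      -- q^{2s}/(1-q).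
      have h4 : q ^ s * q ^ s ≤ q ^ s * (1 - q) :=
        mul_le_mul_of_nonneg_left (by linarith) (by positivity)
      have h5 : (1 - q)⁻¹ * (q ^ s * (1 - q)) = q ^ s := by
        have : 1 - q ≠ 0 := by linarith
        field_simp
      have h6 := mul_le_mul_of_nonneg_left h4 hinv.le
      have h7 : 0 < (1 - q)⁻¹ * q ^ (a + 1) := by positivity
      rw [h3]
      linarith

-- For i < 2m one has min(2m-1-i, i) < m, so no term of the geometric sum is lost.
open Finset in
theorem sigmaRatio_prime_pow_eq {S : Set ℕ} (hS : SetMultiplicative S) {p : ℕ} (hp : p.Prime)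
    {m : ℕ} (hm : 1 ≤ m) (hmem : ∀ j, 1 ≤ j → j < m → p ^ j ∈ S) :
    sigmaRatio S (p ^ (2 * m - 1)) = (1 - (p : ℝ)⁻¹)⁻¹ * (1 - (p : ℝ)⁻¹ ^ (2 * m)) := by
  classical
  have hq := Nat.Primes.inv_le_half ⟨p, hp⟩
  rw [sigmaRatio_prime_pow S hp, show 2 * m - 1 + 1 = 2 * m by omega]
  set q := (p : ℝ)⁻¹ with hqdef
  change q ≤ 1 / 2 at hq
  have : ∀ i ∈ range (2 * m), q ^ i * rhoS S (p ^ min (2 * m - 1 - i) i) = q ^ i := fun i hi => by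
    rw [mem_range] at hi
    rw [rhoS_apply S (pow_ne_zero _ hp.ne_zero), if_pos, mul_one]
    rcases Nat.eq_zero_or_pos (min (2 * m - 1 - i) i) with h0 | h0
    · rw [h0, pow_zero]; exact hS.1
    · exact hmem _ h0 (by omega)
  rw [sum_congr rfl this, geom_sum_eq (by linarith), ← neg_sub 1 q, ← neg_sub 1 (q ^ (2 * m)),
    neg_div_neg_eq, div_eq_inv_mul]

/-! ### Convergence of the limit product and growth of the local suprema -/

theorem multipliable_limitFactor (S : Set ℕ) :
    Multipliable (fun p : {p : ℕ // p.Prime ∧ p ∉ fullPrimes S} =>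
      1 - 1 / ((p : ℕ) : ℝ) ^ (2 * leastExp S p)) := by
  have hs : Summable fun p : {p : ℕ // p.Prime ∧ p ∉ fullPrimes S} =>
      -(1 / ((p : ℕ) : ℝ) ^ (2 * leastExp S p)) := by
    refine Summable.of_norm_bounded
      (((Real.summable_one_div_nat_pow.2 one_lt_two)).subtype
        {p : ℕ | p.Prime ∧ p ∉ fullPrimes S}) fun p => ?_
    have h1 := (leastExp_isLeast S p.2.1 p.2.2).1.1
    have hp : (1 : ℝ) ≤ ((p : ℕ) : ℝ) := by exact_mod_cast p.2.1.one_lt.le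
    rw [norm_neg, Real.norm_of_nonneg (by positivity)]
    exact one_div_le_one_div_of_le (by positivity) (pow_le_pow_right₀ hp (by omega))
  exact (Real.multipliable_one_add_of_summable hs).congr fun p => (sub_eq_add_neg _ _).symm

open Topology Finset in
theorem tendsto_prod_limitFactor (S : Set ℕ) :
    Tendsto (fun N : ℕ => ∏ p ∈ range N, limitFactor S p) atTop
      (𝓝 (∏' p : {p : ℕ // p.Prime ∧ p ∉ fullPrimes S},
        (1 - 1 / ((p : ℕ) : ℝ) ^ (2 * leastExp S p)))) := by
  have h : HasProd ((fun p : ℕ => 1 - 1 / (p : ℝ) ^ (2 * leastExp S p)) ∘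
      ((↑) : {p : ℕ | p.Prime ∧ p ∉ fullPrimes S} → ℕ)) _ := (multipliable_limitFactor S).hasProd
  rw [hasProd_subtype_iff_mulIndicator] at h
  exact h.tendsto_prod_nat

/-- The product over the primes up to `N` of the suprema of the local factors of `σ_S(n) / n`. -/
noncomputable def localSupProd (S : Set ℕ) (N : ℕ) : ℝ :=
  ∏ p ∈ Finset.range (N + 1) with p.Prime, (1 - (p : ℝ)⁻¹)⁻¹ * limitFactor S p

open Topology Finset in
theorem tendsto_localSupProd_div_log (S : Set ℕ) :
    Tendsto (fun N : ℕ => localSupProd S N / Real.log N) atTop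
      (𝓝 (Real.exp Real.eulerMascheroniConstant *
        ∏' p : {p : ℕ // p.Prime ∧ p ∉ fullPrimes S},
          (1 - 1 / ((p : ℕ) : ℝ) ^ (2 * leastExp S p)))) := by
  refine (tendsto_prod_prime_one_sub_inv_div_log.mul
    ((tendsto_prod_limitFactor S).comp (tendsto_add_atTop_nat 1))).congr fun N => ?_
  have : ∏ p ∈ range (N + 1), limitFactor S p =
      ∏ p ∈ range (N + 1) with p.Prime, limitFactor S p := by
    rw [prod_filter]
    refine prod_congr rfl fun p _ => ?_
    split_ifs with hp
    · rfl
    · exact limitFactor_eq_one S fun h => hp h.1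
  simp only [Function.comp_apply]
  rw [this, localSupProd, prod_mul_distrib]
  ring

/-! ### The upper bound -/

-- If k prime factors of n exceed y, then (y+1)^k ≤ n, so k log(y+1) ≤ y+1 ≤ 2y. Each contributes at
-- most 1 + 1/(p-1) ≤ e^{1/y}, together at most e^{k/y}; this explains the constant 2.
open Finset in
theorem sigmaRatio_le {S : Set ℕ} (hS : SetMultiplicative S) {n : ℕ} (hn : n ≠ 0)
    {y : ℕ} (hy : 1 ≤ y) (hny : Real.log n ≤ y + 1) :
    sigmaRatio S n ≤ localSupProd S y * Real.exp (2 / Real.log (y + 1 : ℕ)) := by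
  have hy0 : (1 : ℝ) ≤ y := by exact_mod_cast hy
  have hF := fun (p : ℕ) (hp : p.Prime) => one_sub_inv_mul_limitFactor_ge_one S hp
  set F : ℕ → ℝ := fun p => (1 - (p : ℝ)⁻¹)⁻¹ * limitFactor S p with hFdef
  have hlogy : 0 < Real.log (y + 1 : ℕ) := Real.log_pos (by push_cast; linarith)
  have h1 : sigmaRatio S n ≤ ∏ p ∈ n.primeFactors, F p := by
    rw [sigmaRatio_eq_prod hS hn]
    exact prod_le_prod (fun p _ => sigmaRatio_nonneg S _) fun p hp =>
      sigmaRatio_prime_pow_le S (Nat.prime_of_mem_primeFactors hp) _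
  refine h1.trans ?_
  rw [← prod_filter_mul_prod_filter_not n.primeFactors (fun p => p ≤ y)]
  refine mul_le_mul ?_ ?_ (prod_nonneg fun p hp => ?_) (prod_nonneg fun p hp => ?_)
  · refine prod_le_prod_of_subset_of_one_le ?_ (fun p hp => ?_) fun p hp _ => ?_
    · intro p hp
      obtain ⟨hp1, hp2⟩ := mem_filter.1 hp
      exact mem_filter.2 ⟨mem_range.2 (by omega), Nat.prime_of_mem_primeFactors hp1⟩
    · exact zero_le_one.trans (hF p (Nat.prime_of_mem_primeFactors (mem_filter.1 hp).1))
    · exact hF p (mem_filter.1 hp).2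
  · set A := n.primeFactors.filter (fun p => ¬ p ≤ y) with hA
    have hcard : (#A : ℝ) * Real.log (y + 1 : ℕ) ≤ y + 1 := by
      have : (y + 1) ^ #A ≤ n := by
        calc (y + 1) ^ #A = ∏ p ∈ A, (y + 1) := by rw [prod_const]
          _ ≤ ∏ p ∈ A, p := prod_le_prod' fun p hp => by
              have := (mem_filter.1 hp).2; omega
          _ ≤ ∏ p ∈ n.primeFactors, p := prod_le_prod_of_subset_of_one_le' (filter_subset _ _)
              fun p hp _ => (Nat.prime_of_mem_primeFactors hp).one_lt.le
          _ ≤ n := Nat.le_of_dvd (Nat.pos_of_ne_zero hn) (Nat.prod_primeFactors_dvd n)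
      rw [← Real.log_pow]
      refine le_trans (Real.log_le_log (by positivity) ?_) hny
      exact_mod_cast this
    have hfac : ∀ p ∈ A, F p ≤ Real.exp (1 / y) := fun p hp => by
      obtain ⟨hp1, hp2⟩ := mem_filter.1 hp
      have hp' := Nat.prime_of_mem_primeFactors hp1
      have hpy : (y : ℝ) + 1 ≤ p := by exact_mod_cast (by omega : y + 1 ≤ p)
      have hp0 : (0 : ℝ) < p := by linarith
      have hlf : limitFactor S p ≤ 1 := by
        by_cases hP : p ∈ fullPrimes S
        · rw [limitFactor_eq_one S (by simp [hP])]
        · rw [limitFactor_apply S hp' hP]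
          have : 0 ≤ 1 / (p : ℝ) ^ (2 * leastExp S p) := by positivity
          linarith
      have hinv : (1 - (p : ℝ)⁻¹)⁻¹ = 1 + 1 / (p - 1) := by
        have : (p : ℝ) - 1 ≠ 0 := by linarith
        field_simp
        ring
      have hinv0 : (0 : ℝ) ≤ 1 + 1 / (p - 1) := by
        have : (0 : ℝ) < p - 1 := by linarith
        positivity
      calc F p ≤ 1 + 1 / (p - 1) := by
            simp only [hFdef, hinv]
            exact mul_le_of_le_one_right hinv0 hlf
        _ ≤ 1 + 1 / y := by
            gcongr
            linarith
        _ ≤ Real.exp (1 / y) := by linarith [Real.add_one_le_exp (1 / (y : ℝ))]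
    calc ∏ p ∈ A, F p ≤ ∏ p ∈ A, Real.exp (1 / y) := prod_le_prod (fun p hp =>
          zero_le_one.trans (hF p (Nat.prime_of_mem_primeFactors (mem_filter.1 hp).1))) hfac
      _ = Real.exp (#A * (1 / y)) := by rw [prod_const, ← Real.exp_nat_mul]
      _ ≤ _ := by
        rw [Real.exp_le_exp, mul_one_div, div_le_div_iff₀ (by linarith) hlogy]
        linarith
  · exact zero_le_one.trans (hF p (Nat.prime_of_mem_primeFactors (mem_filter.1 hp).1))
  · exact zero_le_one.trans (hF p (mem_filter.1 hp).2)

open Topology in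
theorem limsup_sigmaRatio_le {S : Set ℕ} (hS : SetMultiplicative S) {L : ℝ}
    (hL : Tendsto (fun N : ℕ => localSupProd S N / Real.log N) atTop (𝓝 L)) :
    limsup (fun n : ℕ => ((sigmaRatio S n / Real.log (Real.log n) : ℝ) : EReal)) atTop ≤ L := by
  have hy : Tendsto (fun n : ℕ => ⌊Real.log n⌋₊) atTop atTop :=
    tendsto_nat_floor_atTop.comp (Real.tendsto_log_atTop.comp tendsto_natCast_atTop_atTop)
  have hexp : Tendsto (fun y : ℕ => Real.exp (2 / Real.log (y + 1 : ℕ))) atTop (𝓝 1) := by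
    have h1 : Tendsto (fun y : ℕ => Real.log (y + 1 : ℕ)) atTop atTop :=
      Real.tendsto_log_atTop.comp (tendsto_natCast_atTop_atTop.comp (tendsto_add_atTop_nat 1))
    have h2 := (h1.const_div_atTop 2).rexp
    rwa [Real.exp_zero] at h2
  have hlim := (hL.mul hexp).comp hy
  rw [mul_one] at hlim
  have hlim' := (continuous_coe_real_ereal.tendsto L).comp hlim
  rw [← hlim'.limsup_eq]
  refine limsup_le_limsup ?_
  filter_upwards [hy.eventually_ge_atTop 2, eventually_ge_atTop 1] with n hn hn1
  simp only [Function.comp_apply, EReal.coe_le_coe_iff]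
  set y := ⌊Real.log n⌋₊ with hydef
  have hy2 : (2 : ℝ) ≤ y := by exact_mod_cast hn
  have hlogy : 0 < Real.log y := Real.log_pos (by linarith)
  have hyn : (y : ℝ) ≤ Real.log n := Nat.floor_le (Real.log_natCast_nonneg n)
  have hle := sigmaRatio_le hS (by omega : n ≠ 0) (by omega : 1 ≤ y) (Nat.lt_floor_add_one _).le
  calc sigmaRatio S n / Real.log (Real.log n) ≤ sigmaRatio S n / Real.log y := by
        have := Real.log_le_log (by linarith) hyn
        exact div_le_div_of_nonneg_left (sigmaRatio_nonneg S n) hlogy this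
    _ ≤ localSupProd S y * Real.exp (2 / Real.log (y + 1 : ℕ)) / Real.log y := by gcongr
    _ = _ := by ring

/-! ### The lower bound -/

/-- Near-extremal exponents: the least exponent outside `S`, truncated at `K`. -/
noncomputable def truncExp (S : Set ℕ) (K p : ℕ) : ℕ :=
  open Classical in if p ∈ fullPrimes S then K else min (leastExp S p) K

/-- Near-extremal integers for `σ_S(n) / n`. -/
noncomputable def extremal (S : Set ℕ) (K y : ℕ) : ℕ :=
  ∏ p ∈ Finset.range (y + 1) with p.Prime, p ^ (2 * truncExp S K p - 1)

theorem truncExp_le (S : Set ℕ) (K p : ℕ) : truncExp S K p ≤ K := by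
  unfold truncExp; split_ifs <;> simp

theorem one_le_truncExp (S : Set ℕ) {K : ℕ} (hK : 1 ≤ K) {p : ℕ} (hp : p.Prime) :
    1 ≤ truncExp S K p := by
  unfold truncExp
  split_ifs with hP
  · exact hK
  · exact le_min (leastExp_isLeast S hp hP).1.1 hK

theorem pow_mem_of_lt_truncExp (S : Set ℕ) {K p : ℕ} (hp : p.Prime) (j : ℕ) (h1 : 1 ≤ j)
    (hj : j < truncExp S K p) : p ^ j ∈ S := by
  unfold truncExp at hj
  split_ifs at hj with hP
  · exact hP.2 j h1
  · by_contra hmem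
    exact absurd ((leastExp_isLeast S hp hP).2 ⟨h1, hmem⟩) (by omega)

/-- For p ∉ P the local factor carries 1 - p^{-2 min(s,K)}, one of the two numbers 1 - p^{-2s} and 1
- p^{-2K} in [0,1], hence at least their product. -/
theorem le_sigmaRatio_truncExp {S : Set ℕ} (hS : SetMultiplicative S) {K : ℕ} (hK : 1 ≤ K) {p : ℕ}
    (hp : p.Prime) :
    (1 - (p : ℝ)⁻¹)⁻¹ * limitFactor S p * (1 - (p : ℝ)⁻¹ ^ (2 * K)) ≤
      sigmaRatio S (p ^ (2 * truncExp S K p - 1)) := by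
  have hq := Nat.Primes.inv_le_half ⟨p, hp⟩
  change (p : ℝ)⁻¹ ≤ 1 / 2 at hq
  have hq0 : (0 : ℝ) < (p : ℝ)⁻¹ := inv_pos.2 (by exact_mod_cast hp.pos)
  have hinv : 0 ≤ (1 - (p : ℝ)⁻¹)⁻¹ := inv_nonneg.2 (by linarith)
  rw [sigmaRatio_prime_pow_eq hS hp (one_le_truncExp S hK hp)
    (pow_mem_of_lt_truncExp S hp), mul_assoc]
  refine mul_le_mul_of_nonneg_left ?_ hinv
  have hpow : ∀ k, 0 ≤ 1 - (p : ℝ)⁻¹ ^ k ∧ 1 - (p : ℝ)⁻¹ ^ k ≤ 1 := fun k =>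
    ⟨sub_nonneg.2 (pow_le_one₀ hq0.le (by linarith)), by linarith [pow_pos hq0 k]⟩
  by_cases hP : p ∈ fullPrimes S
  · rw [limitFactor_eq_one S (by simp [hP]), truncExp, if_pos hP, one_mul]
  · rw [limitFactor_apply S hp hP, truncExp, if_neg hP, one_div, ← inv_pow]
    rcases min_choice (leastExp S p) K with h | h <;> rw [h]
    · exact mul_le_of_le_one_right (hpow _).1 (hpow _).2
    · exact mul_le_of_le_one_left (hpow _).1 (hpow _).2

open Finset in
theorem sigmaRatio_prod_prime_pow {S : Set ℕ} (hS : SetMultiplicative S) (e : ℕ → ℕ)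
    (s : Finset ℕ) (hs : ∀ p ∈ s, p.Prime) :
    sigmaRatio S (∏ p ∈ s, p ^ e p) = ∏ p ∈ s, sigmaRatio S (p ^ e p) := by
  induction s using Finset.induction_on with
  | empty => simp [sigmaRatio_one hS]
  | insert p s hps ih =>
    rw [prod_insert hps, prod_insert hps, sigmaRatio_mul_of_coprime hS,
      ih fun q hq => hs q (mem_insert_of_mem hq)]
    refine Nat.Coprime.prod_right fun q hq => Nat.Coprime.pow _ _ ?_
    exact (Nat.coprime_primes (hs p (mem_insert_self p s)) (hs q (mem_insert_of_mem hq))).2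
      fun h => hps (h ▸ hq)

theorem one_sub_sum_le_prod_one_sub {ι : Type*} (s : Finset ι) (f : ι → ℝ)
    (h0 : ∀ i ∈ s, 0 ≤ f i) (h1 : ∀ i ∈ s, f i ≤ 1) :
    1 - ∑ i ∈ s, f i ≤ ∏ i ∈ s, (1 - f i) := by
  classical
  induction s using Finset.induction_on with
  | empty => simp
  | insert a s ha ih =>
    rw [Finset.sum_insert ha, Finset.prod_insert ha]
    have ih' := ih (fun i hi => h0 i (Finset.mem_insert_of_mem hi))
      fun i hi => h1 i (Finset.mem_insert_of_mem hi)
    have hS : 0 ≤ ∑ i ∈ s, f i := Finset.sum_nonneg fun i hi => h0 i (Finset.mem_insert_of_mem hi)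
    have ha0 := h0 a (Finset.mem_insert_self a s)
    have ha1 := h1 a (Finset.mem_insert_self a s)
    nlinarith [mul_le_mul_of_nonneg_left ih' (sub_nonneg.2 ha1), mul_nonneg ha0 hS]

-- Uses p^{-2K} ≤ 4^{-(K-1)} p^{-2}. The bound is uniform in y, so y may go to infinity before K.
open Finset in
theorem one_sub_le_prod_one_sub_inv_pow {K : ℕ} (hK : 1 ≤ K) (y : ℕ) :
    1 - (1 / 4) ^ (K - 1) * ∑' n : ℕ, 1 / (n : ℝ) ^ 2 ≤
      ∏ p ∈ range (y + 1) with p.Prime, (1 - (p : ℝ)⁻¹ ^ (2 * K)) := by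
  have hq : ∀ p ∈ (range (y + 1)).filter Nat.Prime, (p : ℝ)⁻¹ ≤ 1 / 2 := fun p hp =>
    Nat.Primes.inv_le_half ⟨p, (mem_filter.1 hp).2⟩
  refine le_trans ?_ (one_sub_sum_le_prod_one_sub _ _ (fun p _ => by positivity) fun p hp =>
    pow_le_one₀ (by positivity) ((hq p hp).trans (by norm_num)))
  refine sub_le_sub_left ?_ 1
  calc ∑ p ∈ range (y + 1) with p.Prime, (p : ℝ)⁻¹ ^ (2 * K)
      ≤ ∑ p ∈ range (y + 1) with p.Prime, (1 / 4) ^ (K - 1) * (1 / (p : ℝ) ^ 2) := by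
        refine sum_le_sum fun p hp => ?_
        have e : (p : ℝ)⁻¹ ^ (2 * K) = ((p : ℝ)⁻¹ ^ 2) ^ (K - 1) * (1 / (p : ℝ) ^ 2) := by
          rw [one_div, ← inv_pow, ← pow_mul, ← pow_add]
          congr 1
          omega
        rw [e]
        have : (p : ℝ)⁻¹ ^ 2 ≤ 1 / 4 := by
          have := pow_le_pow_left₀ (by positivity) (hq p hp) 2
          norm_num at this ⊢
          exact this
        gcongr
    _ = (1 / 4) ^ (K - 1) * ∑ p ∈ range (y + 1) with p.Prime, 1 / (p : ℝ) ^ 2 := by rw [mul_sum]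
    _ ≤ _ := by
        gcongr
        exact (Real.summable_one_div_nat_pow.2 one_lt_two).sum_le_tsum _ fun n _ => by positivity

theorem le_sigmaRatio_extremal {S : Set ℕ} (hS : SetMultiplicative S) {K : ℕ} (hK : 1 ≤ K)
    (y : ℕ) :
    localSupProd S y * (1 - (1 / 4) ^ (K - 1) * ∑' n : ℕ, 1 / (n : ℝ) ^ 2) ≤
      sigmaRatio S (extremal S K y) := by
  have hF := fun (p : ℕ) (hp : p.Prime) =>
    zero_le_one.trans (one_sub_inv_mul_limitFactor_ge_one S hp)
  calc _ ≤ localSupProd S y *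
        ∏ p ∈ Finset.range (y + 1) with p.Prime, (1 - (p : ℝ)⁻¹ ^ (2 * K)) :=
        mul_le_mul_of_nonneg_left (one_sub_le_prod_one_sub_inv_pow hK y)
          (Finset.prod_nonneg fun p hp => hF p (Finset.mem_filter.1 hp).2)
    _ ≤ _ := by
        rw [extremal, sigmaRatio_prod_prime_pow hS (fun p => 2 * truncExp S K p - 1) _
          fun p hp => (Finset.mem_filter.1 hp).2, localSupProd, ← Finset.prod_mul_distrib]
        refine Finset.prod_le_prod (fun p hp => ?_) fun p hp =>
          le_sigmaRatio_truncExp hS hK (Finset.mem_filter.1 hp).2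
        have hp' := (Finset.mem_filter.1 hp).2
        refine mul_nonneg (hF p hp') (sub_nonneg.2 (pow_le_one₀ (by positivity) ?_))
        exact (Nat.Primes.inv_le_half ⟨p, hp'⟩).trans (by norm_num)

theorem extremal_pos (S : Set ℕ) (K y : ℕ) : 0 < extremal S K y :=
  Finset.prod_pos fun _ hp => pow_pos (Finset.mem_filter.1 hp).2.pos _

theorem tendsto_extremal (S : Set ℕ) {K : ℕ} (hK : 1 ≤ K) :
    Tendsto (extremal S K) atTop atTop := by
  refine tendsto_atTop.2 fun B => ?_
  obtain ⟨p, hpB, hp⟩ := Nat.exists_infinite_primes B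
  filter_upwards [eventually_ge_atTop p] with y hy
  refine hpB.trans (Nat.le_of_dvd (extremal_pos S K y) ?_)
  refine dvd_trans (dvd_pow_self p ?_) (Finset.dvd_prod_of_mem _
    (Finset.mem_filter.2 ⟨Finset.mem_range.2 (Nat.lt_succ_of_le hy), hp⟩))
  have := one_le_truncExp S hK hp
  omega

/-- Chebyshev's θ(y) ≤ y log 4. Only the order of magnitude matters, since the second logarithm
turns the factor into an additive constant. -/
theorem log_extremal_le (S : Set ℕ) (K y : ℕ) :
    Real.log (extremal S K y) ≤ 2 * K * Real.log 4 * y := by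
  have hθ := Chebyshev.theta_le_log4_mul_x (Nat.cast_nonneg (α := ℝ) y)
  have e : Chebyshev.theta y = ∑ p ∈ Finset.range (y + 1) with p.Prime, Real.log p := by
    rw [Chebyshev.theta_eq_sum_Icc, Nat.floor_natCast, Finset.range_eq_Ico]
    rfl
  rw [extremal]
  push_cast
  rw [Real.log_prod fun p hp =>
    pow_ne_zero _ (Nat.cast_ne_zero.2 (Finset.mem_filter.1 hp).2.ne_zero)]
  calc _ ≤ ∑ p ∈ Finset.range (y + 1) with p.Prime, 2 * K * Real.log p := by
        refine Finset.sum_le_sum fun p hp => ?_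
        rw [Real.log_pow]
        have : ((2 * truncExp S K p - 1 : ℕ) : ℝ) ≤ 2 * K := by
          have := truncExp_le S K p
          exact_mod_cast (by omega : 2 * truncExp S K p - 1 ≤ 2 * K)
        exact mul_le_mul_of_nonneg_right this (Real.log_natCast_nonneg p)
    _ = 2 * K * Chebyshev.theta y := by rw [e, Finset.mul_sum]
    _ ≤ 2 * K * (Real.log 4 * y) := by gcongr
    _ = _ := by ring

open Topology in
theorem le_limsup_sigmaRatio_of_truncation {S : Set ℕ} (hS : SetMultiplicative S) {L : ℝ}
    (hL : Tendsto (fun N : ℕ => localSupProd S N / Real.log N) atTop (𝓝 L))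
    {K : ℕ} (hK : 1 ≤ K) :
    ((L * (1 - (1 / 4) ^ (K - 1) * ∑' n : ℕ, 1 / (n : ℝ) ^ 2) : ℝ) : EReal) ≤
      limsup (fun n : ℕ => ((sigmaRatio S n / Real.log (Real.log n) : ℝ) : EReal)) atTop := by
  set B : ℝ := 1 - (1 / 4) ^ (K - 1) * ∑' n : ℕ, 1 / (n : ℝ) ^ 2
  set c : ℝ := Real.log (2 * K * Real.log 4) with hc
  have hn := tendsto_extremal S hK
  have hlog : Tendsto (fun y : ℕ => Real.log (y : ℝ)) atTop atTop :=
    Real.tendsto_log_atTop.comp tendsto_natCast_atTop_atTop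
  have hratio : Tendsto (fun y : ℕ => Real.log y / (Real.log y + c)) atTop (𝓝 1) := by
    have h1 : Tendsto (fun y : ℕ => 1 - c / (Real.log y + c)) atTop (𝓝 (1 - 0)) :=
      tendsto_const_nhds.sub ((tendsto_atTop_add_const_right _ c hlog).const_div_atTop c)
    rw [sub_zero] at h1
    refine h1.congr' ?_
    filter_upwards [hlog.eventually_gt_atTop (-c)] with y hy
    have : Real.log y + c ≠ 0 := by linarith
    field_simp
    ring
  have hlim := (hL.mul_const B).mul hratio
  rw [mul_one] at hlim
  have hlim' := (continuous_coe_real_ereal.tendsto _).comp hlim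
  rw [← hlim'.limsup_eq]
  -- The limsup along the integers `extremal S K y`, y → ∞, is at most the full limsup.
  refine le_trans (limsup_le_limsup ?_) hn.limsup_comp_le_limsup
  have hll : Tendsto (fun y => Real.log (Real.log (extremal S K y))) atTop atTop :=
    Real.tendsto_log_atTop.comp
      (Real.tendsto_log_atTop.comp (tendsto_natCast_atTop_atTop.comp hn))
  filter_upwards [hll.eventually_gt_atTop 0, hlog.eventually_gt_atTop 0,
    (Real.tendsto_log_atTop.comp (tendsto_natCast_atTop_atTop.comp hn)).eventually_gt_atTop 0,
    eventually_ge_atTop 1] with y hy1 hy2 hy3 hy4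
  simp only [Function.comp_apply, EReal.coe_le_coe_iff] at hy3 ⊢
  have hy0 : (0 : ℝ) < y := by positivity
  have hK0 : (0 : ℝ) < 2 * K * Real.log 4 := by
    have := Real.log_pos (by norm_num : (1 : ℝ) < 4)
    positivity
  have hle : Real.log (Real.log (extremal S K y)) ≤ Real.log y + c := by
    rw [hc, add_comm, ← Real.log_mul hK0.ne' hy0.ne']
    exact Real.log_le_log hy3 (log_extremal_le S K y)
  have hden : 0 < Real.log y + c := hy1.trans_le hle
  calc localSupProd S y / Real.log y * B * (Real.log y / (Real.log y + c))
      = localSupProd S y * B / (Real.log y + c) := by field_simp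
    _ ≤ sigmaRatio S (extremal S K y) / (Real.log y + c) := by
        gcongr
        exact le_sigmaRatio_extremal hS hK y
    _ ≤ _ := div_le_div_of_nonneg_left (sigmaRatio_nonneg S _) hy1 hle

open Topology in
theorem le_limsup_sigmaRatio {S : Set ℕ} (hS : SetMultiplicative S) {L : ℝ}
    (hL : Tendsto (fun N : ℕ => localSupProd S N / Real.log N) atTop (𝓝 L)) :
    (L : EReal) ≤
      limsup (fun n : ℕ => ((sigmaRatio S n / Real.log (Real.log n) : ℝ) : EReal)) atTop := by
  have h1 : Tendsto (fun K : ℕ => L * (1 - (1 / 4) ^ (K + 1 - 1) * ∑' n : ℕ, 1 / (n : ℝ) ^ 2))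
      atTop (𝓝 (L * (1 - 0 * ∑' n : ℕ, 1 / (n : ℝ) ^ 2))) := by
    simp only [Nat.add_sub_cancel]
    exact (((tendsto_pow_atTop_nhds_zero_of_lt_one (by norm_num)
      (by norm_num)).mul_const _).const_sub 1).const_mul L
  rw [zero_mul, sub_zero, mul_one] at h1
  exact le_of_tendsto' ((continuous_coe_real_ereal.tendsto L).comp h1) fun K =>
    le_limsup_sigmaRatio_of_truncation hS hL (Nat.le_add_left 1 K)

/-- The infinite product over the primes outside `P` converges (unconditionally), and the upper
limit, taken in the extended reals, has the stated value. -/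
theorem theorem5p1 (S : Set ℕ) (hS : SetMultiplicative S) :
    Multipliable (fun p : {p : ℕ // p.Prime ∧ p ∉ fullPrimes S} =>
      1 - 1 / ((p : ℕ) : ℝ) ^ (2 * leastExp S p)) ∧
    limsup (fun n : ℕ =>
        (((sigmaS S n : ℝ) / ((n : ℝ) * Real.log (Real.log n)) : ℝ) : EReal)) atTop =
      ((Real.exp Real.eulerMascheroniConstant *
        ∏' p : {p : ℕ // p.Prime ∧ p ∉ fullPrimes S},
          (1 - 1 / ((p : ℕ) : ℝ) ^ (2 * leastExp S p)) : ℝ) : EReal) := by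
  refine ⟨multipliable_limitFactor S, ?_⟩
  have hL := tendsto_localSupProd_div_log S
  simp only [← div_div]
  exact le_antisymm (limsup_sigmaRatio_le hS hL) (le_limsup_sigmaRatio hS hL)
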